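/- **Proposition 2.2.** Consider a market with $n$ divisible commodities, $N=\{1,\dots,n\}$. To each $s\in N$ there belong finite sets $I_s$ of traders and $J_s$ of buyers (a participant may be attributed to several commodities). Trader $i\in I_s$ chooses an offer $x_{is}$ with $\alpha'_{is}\le x_{is}\le\alpha''_{is}$, and buyer $j\in J_s$ chooses a bid $y_{js}$ with $\beta'_{js}\le y_{js}\le\beta''_{js}$, where $\alpha'_{is},\beta'_{js}\in\mathbb R$ and $\alpha''_{is},\beta''_{js}\in\mathbb R\cup\{+\infty\}$. Let $b_s\in\mathbb R$ be the external excess demand for commodity $s$, write $w=(x,y)$ with $x=(x_{is})_{s\in N,\,i\in I_s}$ and $y=(y_{js})_{s\in N,\,j\in J_s}$, and let $W$ be the set of all such $w$ that satisfy these bounds and $$\sum_{i\in I_s}x_{is}-\sum_{j\in J_s}y_{js}=b_s\qquad (s\in N).$$ The participants have real price functions $g_{is}(w)$ ($i\in I_s$) and $h_{js}(w)$ ($j\in J_s$), which may depend on the whole vector $w$. Suppose that $W$ is nonempty, that all $g_{is}$ and $h_{js}$ are continuous on $W$, and that the following condition holds. **(C)** There is a number $r>0$ such that for every $w=(x,y)\in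 W$, every $s\in N$ and every $l\in J_s$ with $\beta''_{ls}=+\infty$ and $y_{ls}>\max\{r,\beta'_{ls}\}$ there is $k\in I_s$ with $\alpha''_{ks}=+\infty$, $x_{ks}>\alpha'_{ks}$ and $g_{ks}(w)\ge h_{ls}(w)$. Then the variational inequality $$\sum_{s\in N}\Big[\sum_{i\in I_s}g_{is}(\bar w)(x_{is}-\bar x_{is})-\sum_{j\in J_s}h_{js}(\bar w)(y_{js}-\bar y_{js})\Big]\ge 0\qquad\text{for all } w=(x,y)\in W \tag{2.3}$$ has a solution $\bar w=(\bar x,\bar y)\in W$. If moreover $\alpha'_{is}<\alpha''_{is}$ and $\beta'_{js}<\beta''_{js}$ for all $s\in N$, $i\in I_s$, $j\in J_s$, then $\bar w$ is a market equilibrium point, that is, there is a price vector $\bar p\in\mathbb R^n$ such that for all $s\in N$: * for each $i\in I_s$: $g_{is}(\bar w)\ge\bar p_s$ if $\bar x_{is}=\alpha'_{is}$, $g_{is}(\bar w)=\bar p_s$ if $\alpha'_{is}<\bar x_{is}<\alpha''_{is}$, and $g_{is}(\bar w)\le\bar p_s$ if $\bar x_{is}=\alpha''_{is}$; * for each $j\in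 J_s$: $h_{js}(\bar w)\le\bar p_s$ if $\bar y_{js}=\beta'_{js}$, $h_{js}(\bar w)=\bar p_s$ if $\beta'_{js}<\bar y_{js}<\beta''_{js}$, and $h_{js}(\bar w)\ge\bar p_s$ if $\bar y_{js}=\beta''_{js}$. -/

import Mathlib

/-- Vectors `w = (x, y)` with `x = (x_{is})`, `i ∈ I_s`, and `y = (y_{js})`, `j ∈ J_s`, where `s`
runs over the `n` commodities. A participant may be attributed to several commodities. -/
abbrev MarketVector {n : ℕ} {I J : Type*} (traders : Fin n → Finset I)
    (buyers : Fin n → Finset J) : Type _ :=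
  ((s : Fin n) → traders s → ℝ) × ((s : Fin n) → buyers s → ℝ)

/-- The two-sided market model with `n` divisible commodities. The lower capacity bounds are real,
the upper ones may be `+∞`, and each price may depend on all offer and bid values. -/
structure Market (n : ℕ) (I J : Type*) where
  /-- The finite set `I_s` of traders attributed to commodity `s`. -/
  traders : Fin n → Finset I
  /-- The finite set `J_s` of buyers attributed to commodity `s`. -/
  buyers : Fin n → Finset J
  /-- `α'_{is}` -/
  offerLower : (s : Fin n) → traders s → ℝ
  /-- `α''_{is}` -/
  offerUpper : (s : Fin n) → traders s → WithTop ℝ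
  /-- `β'_{js}` -/
  bidLower : (s : Fin n) → buyers s → ℝ
  /-- `β''_{js}` -/
  bidUpper : (s : Fin n) → buyers s → WithTop ℝ
  /-- The external excess demand `b_s`. -/
  excessDemand : Fin n → ℝ
  /-- `g_{is}` -/
  offerPrice : (s : Fin n) → traders s → MarketVector traders buyers → ℝ
  /-- `h_{js}` -/
  bidPrice : (s : Fin n) → buyers s → MarketVector traders buyers → ℝ

namespace Market

variable {n : ℕ} {I J : Type*}

/-- The space of the vectors `w = (x, y)` of a market. -/
abbrev Vec (M : Market n I J) : Type _ := MarketVector M.traders M.buyers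

/-- The feasible set `W_s` of commodity `s`. -/
def feasibleFor (M : Market n I J) (s : Fin n) :
    Set ((M.traders s → ℝ) × (M.buyers s → ℝ)) :=
  {v | ∑ i, v.1 i - ∑ j, v.2 j = M.excessDemand s ∧
    (∀ i, M.offerLower s i ≤ v.1 i ∧ (v.1 i : WithTop ℝ) ≤ M.offerUpper s i) ∧
    (∀ j, M.bidLower s j ≤ v.2 j ∧ (v.2 j : WithTop ℝ) ≤ M.bidUpper s j)}

/-- The feasible set `W`, the product of the sets `W_s`. -/
def feasible (M : Market n I J) : Set M.Vec :=
  {w | ∀ s, (w.1 s, w.2 s) ∈ M.feasibleFor s}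

/-- `w` solves the variational inequality of the market. -/
def SolvesVI (M : Market n I J) (w : M.Vec) : Prop :=
  w ∈ M.feasible ∧ ∀ v ∈ M.feasible,
    0 ≤ ∑ s, (∑ i, M.offerPrice s i w * (v.1 s i - w.1 s i)
      - ∑ j, M.bidPrice s j w * (v.2 s j - w.2 s j))

/-- The equilibrium conditions on the traders, for the vector `w` and the price vector `p`. -/
def TraderConditions (M : Market n I J) (w : M.Vec) (p : Fin n → ℝ) : Prop :=
  ∀ (s : Fin n) (i : M.traders s),
    (w.1 s i = M.offerLower s i → p s ≤ M.offerPrice s i w) ∧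
    (M.offerLower s i < w.1 s i ∧ (w.1 s i : WithTop ℝ) < M.offerUpper s i →
      M.offerPrice s i w = p s) ∧
    ((w.1 s i : WithTop ℝ) = M.offerUpper s i → M.offerPrice s i w ≤ p s)

/-- The equilibrium conditions on the buyers, for the vector `w` and the price vector `p`. -/
def BuyerConditions (M : Market n I J) (w : M.Vec) (p : Fin n → ℝ) : Prop :=
  ∀ (s : Fin n) (j : M.buyers s),
    (w.2 s j = M.bidLower s j → M.bidPrice s j w ≤ p s) ∧
    (M.bidLower s j < w.2 s j ∧ (w.2 s j : WithTop ℝ) < M.bidUpper s j →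
      M.bidPrice s j w = p s) ∧
    ((w.2 s j : WithTop ℝ) = M.bidUpper s j → p s ≤ M.bidPrice s j w)

/-- `w` is a market equilibrium point. -/
def IsEquilibriumPoint (M : Market n I J) (w : M.Vec) : Prop :=
  w ∈ M.feasible ∧ ∃ p : Fin n → ℝ, M.TraderConditions w p ∧ M.BuyerConditions w p

/-- The coercivity condition (C). -/
def Coercive (M : Market n I J) : Prop :=
  ∃ r : ℝ, 0 < r ∧ ∀ w ∈ M.feasible, ∀ (s : Fin n) (l : M.buyers s), M.bidUpper s l = ⊤ →
    max r (M.bidLower s l) < w.2 s l →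
      ∃ k : M.traders s, M.offerUpper s k = ⊤ ∧ M.offerLower s k < w.1 s k ∧
        M.bidPrice s l w ≤ M.offerPrice s k w

/-- No capacity segment is reduced to a single point. -/
def Nondegenerate (M : Market n I J) : Prop :=
  (∀ (s : Fin n) (i : M.traders s), (M.offerLower s i : WithTop ℝ) < M.offerUpper s i) ∧
  (∀ (s : Fin n) (j : M.buyers s), (M.bidLower s j : WithTop ℝ) < M.bidUpper s j)

end Market

/-! Bids are counted as negative offers, so each commodity becomes a family of volumes with
prescribed sum. Bids without an upper bound are cut off at a large `R`; then all signed ranges are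
bounded below, and the fixed sums make the feasible set compact. The Hartman–Stampacchia theorem
solves the variational inequality there.

Shifting a little volume between two participants of one commodity shows that whoever can decrease
has price at most that of whoever can increase (`price_le_of_exchange`). The cutoff restricts only
decreases of signed volumes, and where it binds, (C) supplies a trader with at least the same price
who can decrease. The comparison thus holds for the original ranges, and a number `c s` separates
the two groups of prices. These separating prices give both the full variational inequality and the
equilibrium conditions.

Hartman–Stampacchia follows from Brouwer's theorem through the metric projection, and Brouwer's
theorem from a volume-polynomial proof of the no-retraction theorem. -/

open MeasureTheory Module Metric

/-! ### Brouwer's fixed point theorem. -/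

section Brouwer

variable {E : Type*} [NormedAddCommGroup E]

theorem exists_polynomial_eval_eq_det_one_add_smul {V : Type*} [AddCommGroup V] [Module ℝ V]
    [FiniteDimensional ℝ V] (A : V →ₗ[ℝ] V) :
    ∃ P : Polynomial ℝ, P.natDegree ≤ Module.finrank ℝ V ∧
      ∀ t, P.eval t = LinearMap.det (1 + t • A) := by
  let b := Module.finBasis ℝ V
  let M := LinearMap.toMatrix b b A
  refine ⟨(Matrix.det ((Polynomial.X : Polynomial ℝ) • M.map Polynomial.C +
    (1 : Matrix _ _ ℝ).map Polynomial.C)), ?_, fun t => ?_⟩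
  · simpa using Polynomial.natDegree_det_X_add_C_le M 1
  · rw [← LinearMap.det_toMatrix b, ← Polynomial.coe_evalRingHom,
      RingHom.map_det]
    congr 1
    ext i j
    by_cases h : i = j <;>
      simp [M, LinearMap.toMatrix_one, h, add_comm] <;> exact mul_comm _ _

/-- For `u ≤ t` a kernel vector of `1 + u • A` would satisfy `‖x‖ ≤ t * C * ‖x‖`, so the determinant
never vanishes on the way from its value 1 at `u = 0`. -/
theorem det_one_add_smul_pos [NormedSpace ℝ E] [FiniteDimensional ℝ E] (A : E →L[ℝ] E) {C t : ℝ}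
    (hA : ‖A‖ ≤ C) (ht : 0 ≤ t) (htC : t * C < 1) :
    0 < LinearMap.det (1 + t • (A : E →ₗ[ℝ] E)) := by
  obtain ⟨P, -, hP⟩ := exists_polynomial_eval_eq_det_one_add_smul (A : E →ₗ[ℝ] E)
  have hne : ∀ u ∈ Set.Icc 0 t, P.eval u ≠ 0 := by
    intro u hu h0
    rw [hP] at h0
    obtain ⟨x, hx, hx0⟩ := Submodule.exists_mem_ne_zero_of_ne_bot
      (LinearMap.bot_lt_ker_of_det_eq_zero h0).ne'
    have hx' : x = -(u • A x) := by
      have : x + u • A x = 0 := by simpa using hx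
      exact eq_neg_of_add_eq_zero_left this
    have h1 : ‖x‖ ≤ t * C * ‖x‖ := by
      calc ‖x‖ = u * ‖A x‖ := by
            conv_lhs => rw [hx']
            rw [norm_neg, norm_smul, Real.norm_of_nonneg hu.1]
        _ ≤ t * (C * ‖x‖) := by
            gcongr
            · exact hu.2
            · exact (A.le_opNorm x).trans (by gcongr)
        _ = _ := by ring
    nlinarith [norm_pos_iff.2 hx0]
  have h0 : P.eval 0 = 1 := by simp [hP]
  by_contra hneg
  rw [← hP] at hneg
  obtain ⟨u, hu, hu0⟩ := intermediate_value_Icc' ht P.continuous.continuousOn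
    (show (0 : ℝ) ∈ Set.Icc (P.eval t) (P.eval 0) from ⟨not_lt.1 hneg, by rw [h0]; norm_num⟩)
  exact hne u hu hu0

/-- Extending by zero a map that vanishes on a sphere preserves its Lipschitz bound. -/
theorem norm_indicator_closedBall_sub_le [NormedSpace ℝ E] {g : E → E} {C ρ : ℝ} (hC : 0 ≤ C)
    (hg : ∀ x ∈ Metric.closedBall (0 : E) ρ, ∀ y ∈ Metric.closedBall (0 : E) ρ,
      ‖g x - g y‖ ≤ C * ‖x - y‖)
    (h0 : ∀ x, ‖x‖ = ρ → g x = 0) (x y : E) :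
    ‖(Metric.closedBall (0 : E) ρ).indicator g x - (Metric.closedBall (0 : E) ρ).indicator g y‖
      ≤ C * ‖x - y‖ := by
  have key : ∀ x ∈ Metric.closedBall (0 : E) ρ, ∀ y ∉ Metric.closedBall (0 : E) ρ,
      ‖g x‖ ≤ C * ‖x - y‖ := by
    intro x hx y hy
    rw [mem_closedBall_zero_iff] at hx hy
    -- The segment from `x` to the outside point `y` crosses the sphere, where `g` vanishes.
    have hcont : ContinuousOn (fun s : ℝ => ‖x + s • (y - x)‖) (Set.Icc 0 1) := by fun_prop
    obtain ⟨s, hs, hsρ⟩ := intermediate_value_Icc zero_le_one hcont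
      (show ρ ∈ Set.Icc _ _ from ⟨by simpa using hx, by simpa using (not_le.1 hy).le⟩)
    have hz := hg x (by simpa using hx) (x + s • (y - x)) (by simpa using hsρ.le)
    rw [h0 _ hsρ, sub_zero] at hz
    refine hz.trans ?_
    gcongr
    rw [show x - (x + s • (y - x)) = s • (x - y) by module, norm_smul, Real.norm_of_nonneg hs.1]
    exact mul_le_of_le_one_left (norm_nonneg _) hs.2
  by_cases hx : x ∈ Metric.closedBall (0 : E) ρ <;> by_cases hy : y ∈ Metric.closedBall (0 : E) ρ
  · simpa [hx, hy] using hg x hx y hy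
  · simpa only [Set.indicator_of_mem hx, Set.indicator_of_notMem hy, sub_zero] using key x hx y hy
  · simpa only [Set.indicator_of_mem hy, Set.indicator_of_notMem hx, zero_sub, norm_neg,
      norm_sub_rev x y] using key y hy x hx
  · simp only [Set.indicator_of_notMem hx, Set.indicator_of_notMem hy, sub_zero, norm_zero]
    positivity

/-- Extended by zero, `t • g` is a contraction on the whole space. Hence the perturbed identity is
injective and, by Banach's theorem, surjective; it fixes all points outside the ball, so it maps the
ball onto itself. -/
theorem injOn_and_image_ball_eq_of_perturbation [NormedSpace ℝ E] [CompleteSpace E] {g : E → E}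
    {C ρ t : ℝ} (hC : 0 ≤ C) (ht : 0 ≤ t) (htC : t * C < 1)
    (hg : ∀ x ∈ Metric.closedBall (0 : E) ρ, ∀ y ∈ Metric.closedBall (0 : E) ρ,
      ‖g x - g y‖ ≤ C * ‖x - y‖)
    (h0 : ∀ x, ‖x‖ = ρ → g x = 0) :
    Set.InjOn (fun x => x + t • g x) (Metric.ball (0 : E) ρ) ∧
      (fun x => x + t • g x) '' Metric.ball (0 : E) ρ = Metric.ball (0 : E) ρ := by
  set G := (Metric.closedBall (0 : E) ρ).indicator g with hG
  have hLip := norm_indicator_closedBall_sub_le hC hg h0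
  rw [← hG] at hLip
  have hGg : ∀ x ∈ Metric.ball (0 : E) ρ, G x = g x := fun x hx =>
    Set.indicator_of_mem (Metric.ball_subset_closedBall hx) _
  have hG0 : ∀ x ∉ Metric.ball (0 : E) ρ, G x = 0 := by
    intro x hx
    by_cases h : x ∈ Metric.closedBall (0 : E) ρ
    · rw [hG, Set.indicator_of_mem h]
      rw [mem_closedBall_zero_iff] at h
      rw [mem_ball_zero_iff, not_lt] at hx
      exact h0 x (le_antisymm h hx)
    · exact Set.indicator_of_notMem h _
  have hinj : ∀ x y, x + t • G x = y + t • G y → x = y := by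
    intro x y hxy
    have h1 : x - y = t • (G y - G x) := by
      rw [smul_sub, sub_eq_sub_iff_add_eq_add, hxy, add_comm]
    have h2 : ‖x - y‖ ≤ t * (C * ‖x - y‖) := by
      conv_lhs => rw [h1, norm_smul, Real.norm_of_nonneg ht, norm_sub_rev]
      gcongr
      exact hLip x y
    by_contra hne
    nlinarith [norm_pos_iff.2 (sub_ne_zero.2 hne)]
  refine ⟨fun x hx y hy hxy => hinj x y ?_, ?_⟩
  · rw [hGg x hx, hGg y hy]; exact hxy
  apply Set.Subset.antisymm
  · rintro _ ⟨x, hx, rfl⟩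
    by_contra hy
    have := hinj x (x + t • g x) (by rw [hG0 _ hy, hGg x hx]; simp)
    refine hy ?_
    change x + t • g x ∈ _
    rwa [← this]
  · intro y hy
    have hK : ContractingWith ⟨t * C, mul_nonneg ht hC⟩ (fun x => y - t • G x) := by
      refine ⟨by exact_mod_cast htC, LipschitzWith.of_dist_le_mul fun a b => ?_⟩
      rw [dist_eq_norm, dist_eq_norm, show y - t • G a - (y - t • G b) = t • (G b - G a) by module,
        norm_smul, Real.norm_of_nonneg ht, norm_sub_rev]
      change _ ≤ t * C * _
      rw [mul_assoc]
      gcongr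
      exact hLip a b
    set x := hK.fixedPoint with hx
    have hfix : y - t • G x = x := hK.fixedPoint_isFixedPt
    have hxy : x + t • G x = y := (sub_eq_iff_eq_add.1 hfix).symm
    have hxb : x ∈ Metric.ball (0 : E) ρ := by
      by_contra h
      rw [hG0 x h, smul_zero, add_zero] at hxy
      exact h (hxy ▸ hy)
    exact ⟨x, hxb, by simpa [hGg x hxb] using hxy⟩

/-- There is no continuously differentiable retraction onto a sphere. -/
theorem not_exists_contDiff_retraction_sphere [InnerProductSpace ℝ E] [FiniteDimensional ℝ E]
    {ρ : ℝ} (hρ : 0 < ρ) {r : E → E} (hr : ContDiff ℝ 1 r) (hnorm : ∀ x, ‖r x‖ = ρ)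
    (hid : ∀ x, ‖x‖ = ρ → r x = x) : False := by
  borelize E
  let μ : Measure E := volume
  set g : E → E := fun x => r x - x with hgdef
  have hg : ContDiff ℝ 1 g := hr.sub contDiff_id
  have hgd : Differentiable ℝ g := hg.differentiable one_ne_zero
  have hrd : Differentiable ℝ r := hr.differentiable one_ne_zero
  have hg'c : Continuous (fderiv ℝ g) := hg.continuous_fderiv one_ne_zero
  obtain ⟨C, hC⟩ := (isCompact_closedBall (0 : E) ρ).exists_bound_of_continuousOn
    hg'c.continuousOn
  have hC0 : 0 ≤ C := (norm_nonneg _).trans (hC 0 (by simpa using hρ.le))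
  have hLip : ∀ x ∈ Metric.closedBall (0 : E) ρ, ∀ y ∈ Metric.closedBall (0 : E) ρ,
      ‖g x - g y‖ ≤ C * ‖x - y‖ := fun x hx y hy =>
    (convex_closedBall (0 : E) ρ).norm_image_sub_le_of_norm_fderiv_le
      (fun z _ => hgd z) hC hy hx
  have hg0 : ∀ x, ‖x‖ = ρ → g x = 0 := fun x hx => by simp [hgdef, hid x hx]
  -- The Jacobian of `x + t • g x`, polynomial in `t`. Its integral over the ball is the volume of
  -- the ball for small `t`, but vanishes at `t = 1`, where the map is `r`.
  let D : ℝ → E → ℝ := fun t x => LinearMap.det (1 + t • (fderiv ℝ g x : E →ₗ[ℝ] E))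
  have hDint : ∀ t, 0 ≤ t → t * C < 1 → IntegrableOn (D t) (Metric.ball 0 ρ) μ ∧
      ∫ x in Metric.ball 0 ρ, D t x ∂μ = μ.real (Metric.ball 0 ρ) := by
    intro t ht htC
    obtain ⟨hinj, himg⟩ := injOn_and_image_ball_eq_of_perturbation hC0 ht htC hLip hg0
    have hder : ∀ x ∈ Metric.ball (0 : E) ρ, HasFDerivWithinAt (fun x => x + t • g x)
        (1 + t • fderiv ℝ g x) (Metric.ball 0 ρ) x := fun x _ =>
      ((hasFDerivAt_id x).add ((hgd x).hasFDerivAt.const_smul t)).hasFDerivWithinAt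
    have hcont : Continuous (fun x => (1 + t • fderiv ℝ g x).det) :=
      ContinuousLinearMap.continuous_det.comp (by fun_prop)
    have hDeq : ∀ x, D t x = (1 + t • fderiv ℝ g x).det := fun x => rfl
    have h := integral_image_eq_integral_abs_det_fderiv_smul μ Metric.isOpen_ball.measurableSet
      hder hinj (fun _ => (1 : ℝ))
    rw [himg] at h
    refine ⟨?_, ?_⟩
    · exact (hcont.continuousOn.integrableOn_compact (isCompact_closedBall (0 : E) ρ)).mono_set
        Metric.ball_subset_closedBall
    · simp only [integral_const, smul_eq_mul, mul_one, MeasurableSet.univ, measureReal_restrict_apply,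
        Set.univ_inter] at h
      rw [h]
      refine setIntegral_congr_fun Metric.isOpen_ball.measurableSet fun x hx => ?_
      have hpos := det_one_add_smul_pos (fderiv ℝ g x) (hC x (Metric.ball_subset_closedBall hx)) ht htC
      exact (abs_of_pos hpos).symm
  -- Since `‖r‖` is constant, the range of the derivative of `r` at `x` is orthogonal to `r x`, so
  -- the derivative is not onto.
  have hD1 : ∀ x, D 1 x = 0 := by
    intro x
    by_contra hdet
    have hfr : fderiv ℝ g x = fderiv ℝ r x - ContinuousLinearMap.id ℝ E := by
      rw [hgdef, fderiv_fun_sub (hrd x) differentiableAt_fun_id, fderiv_fun_id]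
    have hlin : (1 : E →ₗ[ℝ] E) + (1 : ℝ) • (fderiv ℝ g x : E →ₗ[ℝ] E) = fderiv ℝ r x := by
      rw [hfr]; ext v; simp
    obtain ⟨v, hv⟩ : ∃ v, fderiv ℝ r x v = r x := by
      have hs := (LinearMap.equivOfDetNeZero _ hdet).surjective (r x)
      obtain ⟨v, hv⟩ := hs
      exact ⟨v, by rw [← hv]; simp [LinearMap.equivOfDetNeZero, hfr]⟩
    have h1 : HasFDerivAt (fun y => ‖r y‖ ^ 2) (2 • (innerSL ℝ (r x)).comp (fderiv ℝ r x)) x :=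
      (hrd x).hasFDerivAt.norm_sq
    have h2 : HasFDerivAt (fun y => ‖r y‖ ^ 2) (0 : E →L[ℝ] ℝ) x := by
      simp only [hnorm]; exact hasFDerivAt_const _ _
    have h3 := congrArg (fun A : E →L[ℝ] ℝ => A v) (h1.unique h2)
    simp [hv, hnorm] at h3
    exact hρ.ne' h3
  set d := finrank ℝ E
  -- All `d + 1` multiples `i * τ` with `i ≤ d` satisfy `i * τ * C < 1`, and they suffice to
  -- interpolate a polynomial of degree at most `d` at 1.
  let τ : ℝ := 1 / ((d + 1) * (C + 1))
  have hτ : 0 < τ := by positivity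
  let nodes : ℕ → ℝ := fun i => i * τ
  have hinj : Set.InjOn nodes (Finset.range (d + 1)) := fun i _ j _ hij => by
    have := mul_right_cancel₀ hτ.ne' hij
    exact_mod_cast this
  have hnodes : ∀ i ∈ Finset.range (d + 1), 0 ≤ nodes i ∧ nodes i * C < 1 := by
    intro i hi
    have hi' : (i : ℝ) < d + 1 := by exact_mod_cast Finset.mem_range.1 hi
    refine ⟨by positivity, ?_⟩
    have : nodes i * C = i * C / ((d + 1) * (C + 1)) := by simp only [nodes, τ]; ring
    rw [this, div_lt_one (by positivity)]
    nlinarith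
  let c : ℕ → ℝ := fun i => (Lagrange.basis (Finset.range (d + 1)) nodes i).eval 1
  have hc : ∑ i ∈ Finset.range (d + 1), c i = 1 := by
    simp only [c]
    rw [← Polynomial.eval_finsetSum, Lagrange.sum_basis hinj ⟨0, by simp⟩, Polynomial.eval_one]
  have hinterp : ∀ x, ∑ i ∈ Finset.range (d + 1), D (nodes i) x * c i = 0 := by
    intro x
    obtain ⟨P, hdeg, hP⟩ := exists_polynomial_eval_eq_det_one_add_smul (fderiv ℝ g x : E →ₗ[ℝ] E)
    have hlt : P.degree < (Finset.range (d + 1)).card := by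
      rw [Finset.card_range]
      exact (Polynomial.degree_le_of_natDegree_le hdeg).trans_lt (by exact_mod_cast Nat.lt_succ_self d)
    have h := congrArg (Polynomial.eval 1) (Lagrange.eq_interpolate hinj hlt)
    rw [hP, Lagrange.interpolate_apply, Polynomial.eval_finsetSum] at h
    simp only [Polynomial.eval_mul, Polynomial.eval_C, hP] at h
    exact h.symm.trans (hD1 x)
  have hzero : ∫ x in Metric.ball (0 : E) ρ,
      ∑ i ∈ Finset.range (d + 1), D (nodes i) x * c i ∂μ = 0 := by simp [hinterp]
  rw [integral_finsetSum _ fun i hi =>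
    ((hDint _ (hnodes i hi).1 (hnodes i hi).2).1.mul_const (c i))] at hzero
  have : ∑ i ∈ Finset.range (d + 1), μ.real (Metric.ball (0 : E) ρ) * c i = 0 := by
    rw [← hzero]
    refine Finset.sum_congr rfl fun i hi => ?_
    rw [integral_mul_const, (hDint _ (hnodes i hi).1 (hnodes i hi).2).2]
  rw [← Finset.mul_sum, hc, mul_one] at this
  exact (ENNReal.toReal_pos (Metric.measure_ball_pos μ (0 : E) hρ).ne'
    measure_ball_lt_top.ne).ne' this

/-- A form of the Brouwer fixed point theorem. -/
theorem exists_fixedPoint_of_continuous_of_norm_le [InnerProductSpace ℝ E] [FiniteDimensional ℝ E]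
    {f : E → E} (hf : Continuous f) {R : ℝ} (hR : ∀ x, ‖f x‖ ≤ R) : ∃ x, f x = x := by
  by_contra! hne
  set S : ℝ := R + 1
  have hS : 0 < S := by linarith [(norm_nonneg _).trans (hR 0)]
  obtain ⟨x₀, -, hx₀⟩ := (isCompact_closedBall (0 : E) (3 * S)).exists_isMinOn
    ⟨0, by simpa using hS.le⟩ (f := fun x => ‖x - f x‖) (by fun_prop)
  -- An approximation of `f` within the least displacement has no fixed point in the ball; the cap 1
  -- keeps its values within `S = R + 1`.
  set ε := min ‖x₀ - f x₀‖ 1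
  have hε : 0 < ε := lt_min (norm_pos_iff.2 (sub_ne_zero.2 (hne x₀).symm)) one_pos
  obtain ⟨F, hFd, hF, -⟩ := hf.exists_contDiff_approx 1 (ε := fun _ => ε) continuous_const fun _ => hε
  have hFf : ∀ x, ‖F x - f x‖ < ε := fun x => by simpa [dist_eq_norm] using hF x
  have hFS : ∀ x, ‖F x‖ ≤ S := fun x => by
    have := norm_le_norm_add_norm_sub' (F x) (f x)
    have h1 : ε ≤ 1 := min_le_right _ _
    linarith [hR x, hFf x]
  -- A zero of `φ` would have norm at most `S`, where `χ = 1`, and so be a fixed point of `F`. On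
  -- the sphere of radius `3 * S`, `χ = 0` and `φ` is the identity.
  let χ : ContDiffBump (0 : E) := ⟨2 * S, 3 * S, by positivity, by linarith⟩
  let φ : E → E := fun x => x - χ x • F x
  have hφ0 : ∀ x, φ x ≠ 0 := by
    intro x h
    have hx : x = χ x • F x := sub_eq_zero.1 h
    have hxS : ‖x‖ ≤ S := by
      rw [hx, norm_smul, Real.norm_of_nonneg χ.nonneg]
      exact (mul_le_of_le_one_left (norm_nonneg _) χ.le_one).trans (hFS x)
    have h1 : χ x = 1 := χ.one_of_mem_closedBall (by
      rw [mem_closedBall_zero_iff]; change ‖x‖ ≤ 2 * S; linarith)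
    rw [h1, one_smul] at hx
    have h2 : ‖x₀ - f x₀‖ ≤ ‖x - f x‖ := hx₀ (by rw [mem_closedBall_zero_iff]; linarith)
    have h3 := hFf x
    rw [← hx] at h3
    exact absurd (h3.trans_le (min_le_left _ _)) (not_lt.2 h2)
  have hφ : ContDiff ℝ 1 φ := contDiff_id.sub (χ.contDiff.smul hFd)
  refine not_exists_contDiff_retraction_sphere (E := E) (ρ := 3 * S)
    (r := fun x => (3 * S * ‖φ x‖⁻¹) • φ x) (by positivity) ?_ ?_ ?_
  · exact (contDiff_const.mul ((hφ.norm ℝ hφ0).inv fun x => norm_ne_zero_iff.2 (hφ0 x))).smul hφ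
  · intro x
    have := norm_pos_iff.2 (hφ0 x)
    rw [norm_smul, Real.norm_of_nonneg (by positivity)]
    field_simp
  · intro x hx
    have h1 : χ x = 0 := χ.zero_of_le_dist (by
      rw [dist_zero_right, hx])
    have h2 : φ x = x := by simp [φ, h1]
    simp only [h2, hx]
    rw [mul_inv_cancel₀ (by positivity), one_smul]

end Brouwer

/-! ### Variational inequalities on compact convex sets. -/

section VariationalInequality

theorem exists_continuous_projection {E : Type*} [NormedAddCommGroup E] [InnerProductSpace ℝ E]
    {K : Set E} (hne : K.Nonempty) (hK : IsComplete K) (hconv : Convex ℝ K) :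
    ∃ P : E → E, Continuous P ∧ (∀ x, P x ∈ K) ∧
      ∀ x, ∀ v ∈ K, inner ℝ (x - P x) (v - P x) ≤ 0 := by
  choose P hPK hP using fun x => exists_norm_eq_iInf_of_complete_convex hne hK hconv x
  have hP' : ∀ x, ∀ v ∈ K, inner ℝ (x - P x) (v - P x) ≤ 0 := fun x =>
    (norm_eq_iInf_iff_real_inner_le_zero hconv (hPK x)).1 (hP x)
  refine ⟨P, ?_, hPK, hP'⟩
  refine (LipschitzWith.of_dist_le_mul (K := 1) fun x y => ?_).continuous
  rw [dist_eq_norm, dist_eq_norm, NNReal.coe_one, one_mul]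
  have h1 := hP' x (P y) (hPK y)
  have h2 := hP' y (P x) (hPK x)
  have h3 : ‖P x - P y‖ ^ 2 ≤ inner ℝ (x - y) (P x - P y) := by
    rw [← real_inner_self_eq_norm_sq]
    have e1 : inner ℝ (x - y) (P x - P y) - inner ℝ (P x - P y) (P x - P y) =
        -(inner ℝ (x - P x) (P y - P x) + inner ℝ (y - P y) (P x - P y)) := by
      rw [show P y - P x = -(P x - P y) by abel, inner_neg_right, ← inner_sub_left,
        neg_add, neg_neg, ← sub_eq_add_neg, ← inner_sub_left]
      congr 1
      abel
    linarith
  have h4 := real_inner_le_norm (x - y) (P x - P y)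
  by_contra! hlt
  nlinarith [norm_nonneg (x - y)]

/-- A fixed point of `x ↦ P (x - F (P x))` lies in `K`, and the obtuse-angle property of the
projection there is the claim. The inner `P` is needed because `F` is continuous only on `K`. -/
theorem exists_inner_variational_inequality {E : Type*} [NormedAddCommGroup E]
    [InnerProductSpace ℝ E] [FiniteDimensional ℝ E] {K : Set E} (hne : K.Nonempty)
    (hK : IsCompact K) (hconv : Convex ℝ K) {F : E → E} (hF : ContinuousOn F K) :
    ∃ x ∈ K, ∀ v ∈ K, 0 ≤ inner ℝ (F x) (v - x) := by
  obtain ⟨P, hPc, hPK, hP⟩ := exists_continuous_projection hne hK.isComplete hconv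
  have hPid : ∀ x ∈ K, P x = x := by
    intro x hx
    have := hP x x hx
    rw [real_inner_self_nonpos, sub_eq_zero] at this
    exact this.symm
  obtain ⟨R, hR⟩ := hK.isBounded.exists_norm_le
  obtain ⟨x, hx⟩ := exists_fixedPoint_of_continuous_of_norm_le (f := fun x => P (x - F (P x)))
    (hPc.comp (continuous_id.sub (hF.comp_continuous hPc hPK))) (fun x => hR _ (hPK _))
  have hxK : x ∈ K := hx ▸ hPK _
  refine ⟨x, hxK, fun v hv => ?_⟩
  have := hP (x - F (P x)) v hv
  rw [hx, hPid x hxK, sub_sub_cancel_left, inner_neg_left] at this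
  linarith

/-- The Hartman–Stampacchia theorem, in coordinates. -/
theorem exists_variational_inequality {ι : Type*} [Fintype ι] {K : Set (ι → ℝ)}
    (hne : K.Nonempty) (hK : IsCompact K) (hconv : Convex ℝ K) {F : (ι → ℝ) → ι → ℝ}
    (hF : ContinuousOn F K) : ∃ x ∈ K, ∀ v ∈ K, 0 ≤ ∑ i, F x i * (v i - x i) := by
  let e := EuclideanSpace.equiv ι ℝ
  obtain ⟨x, hx, h⟩ := exists_inner_variational_inequality (K := e ⁻¹' K)
    (F := fun x => e.symm (F (e x))) (hne.preimage e.surjective)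
    (e.toHomeomorph.isCompact_preimage.2 hK) (hconv.linear_preimage e.toLinearMap)
    (e.symm.continuous.comp_continuousOn (hF.comp e.continuous.continuousOn fun _ hx => hx))
  refine ⟨e x, hx, fun v hv => ?_⟩
  have := h (e.symm v) (by simpa using hv)
  simpa [PiLp.inner_apply, e, mul_comm] using this

end VariationalInequality

/-! ### Allocations with prescribed sums and separating prices. -/

section Allocation

/-- The vectors with coordinates in the given ranges whose sum over each fibre is prescribed. -/
def allocations {σ : Type*} {κ : σ → Type*} [∀ s, Fintype (κ s)] (A : (Σ s, κ s) → Set ℝ)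
    (b : σ → ℝ) : Set ((Σ s, κ s) → ℝ) :=
  {z | (∀ p, z p ∈ A p) ∧ ∀ s, ∑ k, z ⟨s, k⟩ = b s}

/-- Some larger point lies in the set. -/
def CanIncrease (A : Set ℝ) (t : ℝ) : Prop := ∃ ε > 0, t + ε ∈ A

/-- Some smaller point lies in the set. -/
def CanDecrease (A : Set ℝ) (t : ℝ) : Prop := ∃ ε > 0, t - ε ∈ A

variable {σ : Type*} {κ : σ → Type*} [∀ s, Fintype (κ s)]
  {A A' : (Σ s, κ s) → Set ℝ} {b : σ → ℝ}

theorem convex_allocations (hA : ∀ p, (A p).OrdConnected) : Convex ℝ (allocations A b) := by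
  intro x hx y hy a c ha hc hac
  refine ⟨fun p => (hA p).convex (hx.1 p) (hy.1 p) ha hc hac, fun s => ?_⟩
  simp only [Pi.add_apply, Pi.smul_apply, smul_eq_mul, Finset.sum_add_distrib, ← Finset.mul_sum,
    hx.2, hy.2]
  rw [← add_mul, hac, one_mul]

/-- A coordinate is at most the fibre total minus the lower bounds of the other coordinates. -/
theorem isCompact_allocations (hcl : ∀ p, IsClosed (A p)) (hbdd : ∀ p, BddBelow (A p)) :
    IsCompact (allocations A b) := by
  choose lo hlo using hbdd
  have hclosed : IsClosed (allocations A b) := by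
    simp only [allocations, Set.ofPred_and, Set.ofPred_forall]
    exact (isClosed_iInter fun p => (hcl p).preimage (continuous_apply p)).inter
      (isClosed_iInter fun s => isClosed_eq (by fun_prop) continuous_const)
  refine (isCompact_Icc (a := lo)
    (b := fun p => b p.1 - ∑ k, lo ⟨p.1, k⟩ + lo p)).of_isClosed_subset hclosed fun z hz => ?_
  refine ⟨fun p => hlo p (hz.1 p), fun ⟨s, l⟩ => ?_⟩
  have h := Finset.single_le_sum (f := fun k => z ⟨s, k⟩ - lo ⟨s, k⟩)
    (fun k _ => sub_nonneg.2 (hlo _ (hz.1 _))) (Finset.mem_univ l)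
  rw [Finset.sum_sub_distrib, hz.2] at h
  change z ⟨s, l⟩ ≤ b s - _ + lo ⟨s, l⟩
  linarith

/-- Moving a small `δ` from `l` to `k` stays feasible and makes the sum equal to `δ * (G k - G l)`.
-/
theorem price_le_of_exchange [Fintype σ] (hA : ∀ p, (A p).OrdConnected) {z : (Σ s, κ s) → ℝ}
    (hz : z ∈ allocations A b) {G : (Σ s, κ s) → ℝ}
    (hvi : ∀ v ∈ allocations A b, 0 ≤ ∑ p, G p * (v p - z p)) {s : σ} {k l : κ s}
    (hk : CanIncrease (A ⟨s, k⟩) (z ⟨s, k⟩)) (hl : CanDecrease (A ⟨s, l⟩) (z ⟨s, l⟩)) :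
    G ⟨s, l⟩ ≤ G ⟨s, k⟩ := by
  classical
  by_cases hkl : k = l
  · rw [hkl]
  obtain ⟨ε, hε, hk⟩ := hk
  obtain ⟨η, hη, hl⟩ := hl
  set p : Σ s, κ s := ⟨s, k⟩
  set q : Σ s, κ s := ⟨s, l⟩
  have hpq : p ≠ q := fun h => hkl (by simpa [p, q] using h)
  set δ := min ε η
  have hδ : 0 < δ := lt_min hε hη
  have hδε : δ ≤ ε := min_le_left _ _
  have hδη : δ ≤ η := min_le_right _ _
  let v : (Σ s, κ s) → ℝ := fun r => z r + δ * ((Pi.single p 1 : _ → ℝ) r - (Pi.single q 1 : _ → ℝ) r)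
  have hsum : ∀ (m : κ s) (s' : σ), ∑ k', (Pi.single (⟨s, m⟩ : Σ s, κ s) 1 : _ → ℝ) ⟨s', k'⟩ =
      if s = s' then 1 else 0 := by
    intro m s'
    by_cases h : s = s'
    · subst h
      simp [Pi.single_apply]
    · rw [if_neg h]
      refine Finset.sum_eq_zero fun k' _ => ?_
      rw [Pi.single_apply, if_neg]
      rintro h'
      exact h (congrArg Sigma.fst h').symm
  have hv : v ∈ allocations A b := by
    refine ⟨fun r => ?_, fun s' => ?_⟩
    · by_cases hrp : r = p
      · have : v p = z p + δ := by simp [v, hpq]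
        rw [hrp, this]
        exact (hA p).out (hz.1 p) hk ⟨by linarith, by linarith⟩
      · by_cases hrq : r = q
        · have : v q = z q - δ := by simp [v, hpq.symm, sub_eq_add_neg]
          rw [hrq, this]
          exact (hA q).out hl (hz.1 q) ⟨by linarith, by linarith⟩
        · have : v r = z r := by simp [v, hrp, hrq]
          rw [this]
          exact hz.1 r
    · simp only [v]
      rw [Finset.sum_add_distrib, hz.2, ← Finset.mul_sum, Finset.sum_sub_distrib, hsum, hsum]
      simp
  have h := hvi v hv
  have he : ∑ r, G r * (v r - z r) = δ * (G p - G q) := by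
    simp only [v, add_sub_cancel_left, mul_sub, Finset.sum_sub_distrib, Pi.single_apply, mul_ite,
      mul_one, mul_zero, Finset.sum_ite_eq', Finset.mem_univ, if_true]
    ring
  rw [he] at h
  exact sub_nonneg.1 (nonneg_of_mul_nonneg_right h hδ)

/-- Two finite families of reals, one below the other, can be separated by a number. -/
theorem exists_forall_le_and_forall_le {L U : Set ℝ} (hL : L.Finite) (hU : U.Finite)
    (h : ∀ x ∈ L, ∀ y ∈ U, x ≤ y) : ∃ c, (∀ y ∈ U, c ≤ y) ∧ ∀ x ∈ L, x ≤ c := by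
  -- For empty `L` the default `sSup ∅ = 0` need not lie below `U`.
  rcases L.eq_empty_or_nonempty with rfl | hne
  · obtain ⟨c, hc⟩ := hU.bddBelow
    exact ⟨c, fun y hy => hc hy, by simp⟩
  · exact ⟨sSup L, fun y hy => csSup_le hne fun x hx => h x hx y hy,
      fun x hx => le_csSup hL.bddAbove hx⟩

/-- Prices for which every increasable coordinate is at least as expensive, and every decreasable
one at most as expensive, solve the variational inequality. -/
theorem sum_mul_sub_nonneg_of_price [Fintype σ] {z v : (Σ s, κ s) → ℝ}
    (hz : z ∈ allocations A b) (hv : v ∈ allocations A b) {G : (Σ s, κ s) → ℝ} {c : σ → ℝ}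
    (hinc : ∀ p, CanIncrease (A p) (z p) → c p.1 ≤ G p)
    (hdec : ∀ p, CanDecrease (A p) (z p) → G p ≤ c p.1) :
    0 ≤ ∑ p, G p * (v p - z p) := by
  -- Equal totals make a price that is constant on each commodity contribute nothing, so `G` may be
  -- compared with `c` term by term.
  have h0 : ∑ p : Σ s, κ s, c p.1 * (v p - z p) = 0 := by
    rw [Fintype.sum_sigma]
    refine Finset.sum_eq_zero fun s _ => ?_
    dsimp only
    rw [← Finset.mul_sum, Finset.sum_sub_distrib, hv.2, hz.2, sub_self, mul_zero]
  refine h0.symm.le.trans (Finset.sum_le_sum fun p _ => sub_nonneg.1 ?_)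
  rw [← sub_mul]
  rcases lt_trichotomy (z p) (v p) with h | h | h
  · have := hinc p ⟨v p - z p, sub_pos.2 h, by simpa using hv.1 p⟩
    exact mul_nonneg (sub_nonneg.2 this) (sub_nonneg.2 h.le)
  · simp [h]
  · have := hdec p ⟨z p - v p, sub_pos.2 h, by simpa using hv.1 p⟩
    exact mul_nonneg_of_nonpos_of_nonpos (sub_nonpos.2 this) (sub_nonpos.2 h.le)

/-- Existence of equilibrium prices: the ranges `A'` truncate the ranges `A` in such a way that the
truncation never affects increases and is harmless for decreases. -/
theorem exists_allocation_price [Fintype σ] (hsub : ∀ p, A' p ⊆ A p)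
    (hord : ∀ p, (A' p).OrdConnected) (hcl : ∀ p, IsClosed (A' p)) (hbdd : ∀ p, BddBelow (A' p))
    (hne : (allocations A' b).Nonempty) {G : ((Σ s, κ s) → ℝ) → (Σ s, κ s) → ℝ}
    (hG : ContinuousOn G (allocations A b))
    (hinc : ∀ p, ∀ t ∈ A' p, CanIncrease (A p) t → CanIncrease (A' p) t)
    (hdec : ∀ z ∈ allocations A' b, ∀ s l, CanDecrease (A ⟨s, l⟩) (z ⟨s, l⟩) →
      ∃ k, CanDecrease (A' ⟨s, k⟩) (z ⟨s, k⟩) ∧ G z ⟨s, l⟩ ≤ G z ⟨s, k⟩) :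
    ∃ z ∈ allocations A b, ∃ c : σ → ℝ, (∀ p, CanIncrease (A p) (z p) → c p.1 ≤ G z p) ∧
      ∀ p, CanDecrease (A p) (z p) → G z p ≤ c p.1 := by
  have hsub' : allocations A' b ⊆ allocations A b := fun z hz => ⟨fun p => hsub p (hz.1 p), hz.2⟩
  obtain ⟨z, hz, hvi⟩ := exists_variational_inequality hne (isCompact_allocations hcl hbdd)
    (convex_allocations hord) (hG.mono hsub')
  have hsep : ∀ s, ∃ c, (∀ y ∈ (fun k => G z ⟨s, k⟩) '' {k | CanIncrease (A ⟨s, k⟩) (z ⟨s, k⟩)},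
      c ≤ y) ∧ ∀ x ∈ (fun k => G z ⟨s, k⟩) '' {k | CanDecrease (A ⟨s, k⟩) (z ⟨s, k⟩)}, x ≤ c := by
    intro s
    refine exists_forall_le_and_forall_le ((Set.toFinite _).image _) ((Set.toFinite _).image _) ?_
    rintro _ ⟨l, hl, rfl⟩ _ ⟨k, hk, rfl⟩
    -- The coordinate `l` may be stuck at the cutoff; `m` is no cheaper and can decrease within the
    -- truncation.
    obtain ⟨m, hm, hle⟩ := hdec z hz s l hl
    exact hle.trans (price_le_of_exchange hord hz hvi (hinc _ _ (hz.1 _) hk) hm)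
  choose c hcU hcL using hsep
  exact ⟨z, hsub' hz, c, fun ⟨s, k⟩ hk => hcU s _ ⟨k, hk, rfl⟩,
    fun ⟨s, k⟩ hk => hcL s _ ⟨k, hk, rfl⟩⟩

end Allocation

theorem isClosed_setOf_coe_le (u : WithTop ℝ) : IsClosed {t : ℝ | (t : WithTop ℝ) ≤ u} := by
  cases u with
  | top => simp
  | coe a =>
    simp only [WithTop.coe_le_coe]
    exact isClosed_Iic

theorem exists_pos_coe_add_le {t : ℝ} {u : WithTop ℝ} (h : (t : WithTop ℝ) < u) :
    ∃ ε > 0, ((t + ε : ℝ) : WithTop ℝ) ≤ u := by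
  cases u with
  | top => exact ⟨1, one_pos, le_top⟩
  | coe a => exact ⟨a - t, sub_pos.2 (WithTop.coe_lt_coe.1 h), by simp⟩

/-! ### The market in signed volumes. -/

namespace Market

variable {n : ℕ} {I J : Type*} (M : Market n I J)

/-- The participants of all commodities. -/
abbrev Participant : Type _ := Σ s, (M.traders s ⊕ M.buyers s)

/-- The range of the signed volume (an offer, or minus a bid) of a participant. -/
def signedRange : M.Participant → Set ℝ
  | ⟨s, .inl i⟩ => {t | M.offerLower s i ≤ t ∧ (t : WithTop ℝ) ≤ M.offerUpper s i}
  | ⟨s, .inr j⟩ => {t | M.bidLower s j ≤ -t ∧ ((-t : ℝ) : WithTop ℝ) ≤ M.bidUpper s j}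

/-- The signed ranges in which all bids without an upper capacity bound are at most `R`. -/
def truncatedRange (R : ℝ) : M.Participant → Set ℝ
  | ⟨s, .inl i⟩ => M.signedRange ⟨s, .inl i⟩
  | ⟨s, .inr j⟩ => {t | t ∈ M.signedRange ⟨s, .inr j⟩ ∧ (M.bidUpper s j = ⊤ → -t ≤ R)}

/-- The market vector with the given signed volumes. -/
def ofSigned (z : M.Participant → ℝ) : M.Vec :=
  (fun s i => z ⟨s, .inl i⟩, fun s j => -z ⟨s, .inr j⟩)

/-- The signed volumes of a market vector. -/
def toSigned (w : M.Vec) : M.Participant → ℝ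
  | ⟨s, .inl i⟩ => w.1 s i
  | ⟨s, .inr j⟩ => -w.2 s j

/-- The price function of a participant. -/
def price (w : M.Vec) : M.Participant → ℝ
  | ⟨s, .inl i⟩ => M.offerPrice s i w
  | ⟨s, .inr j⟩ => M.bidPrice s j w

theorem ofSigned_toSigned (w : M.Vec) : M.ofSigned (M.toSigned w) = w := by
  ext s i <;> simp [ofSigned, toSigned]

theorem continuous_ofSigned : Continuous M.ofSigned := by
  unfold ofSigned
  fun_prop

theorem ofSigned_mem_feasible_iff {z : M.Participant → ℝ} :
    M.ofSigned z ∈ M.feasible ↔ z ∈ allocations M.signedRange M.excessDemand := by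
  constructor
  · refine fun h => ⟨?_, fun s => ?_⟩
    · rintro ⟨s, i | j⟩
      · exact (h s).2.1 i
      · exact (h s).2.2 j
    · rw [Fintype.sum_sum_type, ← (h s).1]
      simp [ofSigned]
  · refine fun h s => ⟨?_, fun i => h.1 ⟨s, .inl i⟩, fun j => h.1 ⟨s, .inr j⟩⟩
    rw [← h.2 s, Fintype.sum_sum_type]
    simp [ofSigned]

theorem toSigned_mem {w : M.Vec} (hw : w ∈ M.feasible) :
    M.toSigned w ∈ allocations M.signedRange M.excessDemand := by
  rwa [← ofSigned_mem_feasible_iff, ofSigned_toSigned]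

theorem truncatedRange_subset (R : ℝ) : ∀ p, M.truncatedRange R p ⊆ M.signedRange p
  | ⟨_, .inl _⟩ => subset_rfl
  | ⟨_, .inr _⟩ => fun _ ht => ht.1

theorem ordConnected_truncatedRange (R : ℝ) : ∀ p, (M.truncatedRange R p).OrdConnected
  | ⟨_, .inl _⟩ => ⟨fun _ hx _ hy _ ht =>
      ⟨hx.1.trans ht.1, (WithTop.coe_le_coe.2 ht.2).trans hy.2⟩⟩
  | ⟨_, .inr _⟩ => ⟨fun _ hx _ hy _ ht =>
      ⟨⟨hy.1.1.trans (neg_le_neg ht.2), (WithTop.coe_le_coe.2 (neg_le_neg ht.1)).trans hx.1.2⟩,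
        fun h => (neg_le_neg ht.1).trans (hx.2 h)⟩⟩

theorem isClosed_truncatedRange (R : ℝ) : ∀ p, IsClosed (M.truncatedRange R p)
  | ⟨s, .inl i⟩ => isClosed_Ici.inter (isClosed_setOf_coe_le (M.offerUpper s i))
  | ⟨s, .inr j⟩ => by
      have h1 : IsClosed {t : ℝ | M.bidLower s j ≤ -t} :=
        isClosed_le continuous_const continuous_neg
      have h2 : IsClosed {t : ℝ | M.bidUpper s j = ⊤ → -t ≤ R} := by
        by_cases h : M.bidUpper s j = ⊤
        · simpa only [h, true_imp_iff] using isClosed_le continuous_neg continuous_const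
        · simp [h]
      exact (h1.inter ((isClosed_setOf_coe_le (M.bidUpper s j)).preimage continuous_neg)).inter h2

theorem bddBelow_truncatedRange (R : ℝ) : ∀ p, BddBelow (M.truncatedRange R p)
  | ⟨s, .inl i⟩ => ⟨M.offerLower s i, fun _ ht => ht.1⟩
  | ⟨s, .inr j⟩ => by
      by_cases h : M.bidUpper s j = ⊤
      · exact ⟨-R, fun t ht => neg_le.1 (ht.2 h)⟩
      · obtain ⟨a, ha⟩ := WithTop.ne_top_iff_exists.1 h
        refine ⟨-a, fun t ht => neg_le.1 ?_⟩
        have := ht.1.2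
        rw [← ha] at this
        exact WithTop.coe_le_coe.1 this

theorem canIncrease_truncatedRange (R : ℝ) : ∀ p, ∀ t ∈ M.truncatedRange R p,
    CanIncrease (M.signedRange p) t → CanIncrease (M.truncatedRange R p) t
  | ⟨_, .inl _⟩, _, _, h => h
  | ⟨_, .inr _⟩, _, ht, ⟨ε, hε, h⟩ => ⟨ε, hε, h, fun hu => by linarith [ht.2 hu]⟩

/-- Under condition (C), a price paid by a buyer whose bid is cut off by the truncation does not
exceed the price of a trader who can decrease the offer. -/
theorem exists_canDecrease_truncatedRange {r R : ℝ}
    (hC : ∀ w ∈ M.feasible, ∀ (s : Fin n) (l : M.buyers s), M.bidUpper s l = ⊤ →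
      max r (M.bidLower s l) < w.2 s l → ∃ k : M.traders s, M.offerUpper s k = ⊤ ∧
        M.offerLower s k < w.1 s k ∧ M.bidPrice s l w ≤ M.offerPrice s k w)
    (hR : ∀ s (l : M.buyers s), max r (M.bidLower s l) < R) {z : M.Participant → ℝ}
    (hz : z ∈ allocations (M.truncatedRange R) M.excessDemand) (s : Fin n)
    (p : M.traders s ⊕ M.buyers s) (hp : CanDecrease (M.signedRange ⟨s, p⟩) (z ⟨s, p⟩)) :
    ∃ k, CanDecrease (M.truncatedRange R ⟨s, k⟩) (z ⟨s, k⟩) ∧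
      M.price (M.ofSigned z) ⟨s, p⟩ ≤ M.price (M.ofSigned z) ⟨s, k⟩ := by
  rcases p with i | l
  · exact ⟨.inl i, hp, le_rfl⟩
  by_cases hu : M.bidUpper s l = ⊤
  · rcases lt_or_ge (-z ⟨s, .inr l⟩) R with hlt | hge
    · refine ⟨.inr l, ⟨R + z ⟨s, .inr l⟩, by linarith, ⟨?_, by simp [hu]⟩, fun _ => ?_⟩, le_rfl⟩
      · have := (hz.1 ⟨s, .inr l⟩).1.1
        linarith
      · linarith
    · have hw : M.ofSigned z ∈ M.feasible := M.ofSigned_mem_feasible_iff.2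
        ⟨fun p => M.truncatedRange_subset R p (hz.1 p), hz.2⟩
      obtain ⟨k, hk, hlt, hle⟩ := hC _ hw s l hu ((hR s l).trans_le hge)
      refine ⟨.inl k, ⟨z ⟨s, .inl k⟩ - M.offerLower s k, sub_pos.2 hlt, ?_⟩, hle⟩
      rw [sub_sub_cancel]
      exact ⟨le_rfl, hk ▸ le_top⟩
  · obtain ⟨ε, hε, h⟩ := hp
    exact ⟨.inr l, ⟨ε, hε, h, fun h => absurd h hu⟩, le_rfl⟩

/-- The first property lets (C) apply to bids at the cutoff; the second keeps `w` in the truncated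
set, which is thus nonempty. -/
theorem exists_truncation_bound (r : ℝ) (w : M.Vec) :
    ∃ R, (∀ s (l : M.buyers s), max r (M.bidLower s l) < R) ∧
      ∀ s (l : M.buyers s), w.2 s l ≤ R := by
  obtain ⟨R, hR⟩ := (Set.finite_range fun p : Σ s, M.buyers s =>
    max (max r (M.bidLower p.1 p.2)) (w.2 p.1 p.2)).bddAbove
  refine ⟨R + 1, fun s l => ?_, fun s l => ?_⟩ <;>
  have := max_le_iff.1 (hR ⟨⟨s, l⟩, rfl⟩)
  · exact this.1.trans_lt (lt_add_one R)
  · exact this.2.trans (lt_add_one R).le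

theorem sum_price_mul_eq (w v : M.Vec) :
    ∑ p, M.price w p * (M.toSigned v p - M.toSigned w p) =
      ∑ s, (∑ i, M.offerPrice s i w * (v.1 s i - w.1 s i)
        - ∑ j, M.bidPrice s j w * (v.2 s j - w.2 s j)) := by
  rw [Fintype.sum_sigma]
  refine Finset.sum_congr rfl fun s _ => ?_
  rw [Fintype.sum_sum_type, sub_eq_add_neg, ← Finset.sum_neg_distrib]
  congr 1
  refine Finset.sum_congr rfl fun j _ => ?_
  simp only [price, toSigned]
  ring

/-- Nondegeneracy lets a volume at one end of its segment move towards the other end, which yields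
the endpoint conditions; interior volumes move both ways. Raising a bid decreases the signed volume.
-/
theorem isEquilibriumPoint_of_price (hM : M.Nondegenerate) {w : M.Vec} (hw : w ∈ M.feasible)
    {c : Fin n → ℝ}
    (hinc : ∀ p, CanIncrease (M.signedRange p) (M.toSigned w p) → c p.1 ≤ M.price w p)
    (hdec : ∀ p, CanDecrease (M.signedRange p) (M.toSigned w p) → M.price w p ≤ c p.1) :
    M.IsEquilibriumPoint w := by
  have hI : ∀ s (i : M.traders s), (w.1 s i : WithTop ℝ) < M.offerUpper s i →
      c s ≤ M.offerPrice s i w := by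
    intro s i h
    obtain ⟨ε, hε, h⟩ := exists_pos_coe_add_le h
    exact hinc ⟨s, .inl i⟩ ⟨ε, hε, ((hw s).2.1 i).1.trans (le_add_of_nonneg_right hε.le), h⟩
  have hI' : ∀ s (i : M.traders s), M.offerLower s i < w.1 s i → M.offerPrice s i w ≤ c s := by
    intro s i h
    refine hdec ⟨s, .inl i⟩ ⟨w.1 s i - M.offerLower s i, sub_pos.2 h, ?_⟩
    simp only [toSigned, sub_sub_cancel]
    exact ⟨le_rfl, (hM.1 s i).le⟩
  have hJ : ∀ s (j : M.buyers s), (w.2 s j : WithTop ℝ) < M.bidUpper s j →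
      M.bidPrice s j w ≤ c s := by
    intro s j h
    obtain ⟨ε, hε, h⟩ := exists_pos_coe_add_le h
    refine hdec ⟨s, .inr j⟩ ⟨ε, hε, ?_⟩
    have e : -(-w.2 s j - ε) = w.2 s j + ε := by ring
    refine ⟨?_, ?_⟩ <;> simp only [toSigned, e]
    · exact ((hw s).2.2 j).1.trans (le_add_of_nonneg_right hε.le)
    · exact h
  have hJ' : ∀ s (j : M.buyers s), M.bidLower s j < w.2 s j → c s ≤ M.bidPrice s j w := by
    intro s j h
    refine hinc ⟨s, .inr j⟩ ⟨w.2 s j - M.bidLower s j, sub_pos.2 h, ?_⟩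
    have e : -(-w.2 s j + (w.2 s j - M.bidLower s j)) = M.bidLower s j := by ring
    refine ⟨?_, ?_⟩ <;> simp only [toSigned, e]
    · exact le_rfl
    · exact (hM.2 s j).le
  refine ⟨hw, c, fun s i => ⟨fun h => hI s i ?_, fun h => ?_, fun h => hI' s i ?_⟩,
    fun s j => ⟨fun h => hJ s j ?_, fun h => ?_, fun h => hJ' s j ?_⟩⟩
  · rw [h]; exact hM.1 s i
  · exact le_antisymm (hI' s i h.1) (hI s i h.2)
  · exact WithTop.coe_lt_coe.1 (h ▸ hM.1 s i)
  · rw [h]; exact hM.2 s j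
  · exact le_antisymm (hJ s j h.2) (hJ' s j h.1)
  · exact WithTop.coe_lt_coe.1 (h ▸ hM.2 s j)

end Market

theorem proposition2p2 {n : ℕ} {I J : Type*} (M : Market n I J)
    (hW : M.feasible.Nonempty)
    (hg : ∀ (s : Fin n) (i : M.traders s), ContinuousOn (M.offerPrice s i) M.feasible)
    (hh : ∀ (s : Fin n) (j : M.buyers s), ContinuousOn (M.bidPrice s j) M.feasible)
    (hC : M.Coercive) :
    ∃ w : M.Vec, M.SolvesVI w ∧ (M.Nondegenerate → M.IsEquilibriumPoint w) := by
  obtain ⟨w₀, hw₀⟩ := hW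
  obtain ⟨r, -, hC⟩ := hC
  obtain ⟨R, hR, hw₀R⟩ := M.exists_truncation_bound r w₀
  have hne : M.toSigned w₀ ∈ allocations (M.truncatedRange R) M.excessDemand := by
    refine ⟨?_, (M.toSigned_mem hw₀).2⟩
    rintro ⟨s, i | j⟩
    · exact (M.toSigned_mem hw₀).1 ⟨s, .inl i⟩
    · exact ⟨(M.toSigned_mem hw₀).1 ⟨s, .inr j⟩, fun _ => by simpa [Market.toSigned] using hw₀R s j⟩
  have hcont : ContinuousOn (fun z => M.price (M.ofSigned z))
      (allocations M.signedRange M.excessDemand) := by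
    rw [continuousOn_pi]
    rintro ⟨s, i | j⟩
    · exact (hg s i).comp M.continuous_ofSigned.continuousOn fun z hz =>
        M.ofSigned_mem_feasible_iff.2 hz
    · exact (hh s j).comp M.continuous_ofSigned.continuousOn fun z hz =>
        M.ofSigned_mem_feasible_iff.2 hz
  obtain ⟨z, hz, c, hinc, hdec⟩ := exists_allocation_price (M.truncatedRange_subset R)
    (M.ordConnected_truncatedRange R) (M.isClosed_truncatedRange R) (M.bddBelow_truncatedRange R)
    ⟨_, hne⟩ hcont (M.canIncrease_truncatedRange R)
    fun z hz s p hp => M.exists_canDecrease_truncatedRange hC hR hz s p hp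
  have hzw : M.toSigned (M.ofSigned z) = z := by
    ext ⟨s, i | j⟩ <;> simp [Market.toSigned, Market.ofSigned]
  have hw := M.ofSigned_mem_feasible_iff.2 hz
  refine ⟨M.ofSigned z, ⟨hw, fun v hv => ?_⟩, fun hM => ?_⟩
  · rw [← M.sum_price_mul_eq, hzw]
    exact sum_mul_sub_nonneg_of_price hz (M.toSigned_mem hv) hinc hdec
  · exact M.isEquilibriumPoint_of_price hM hw (by rwa [hzw]) (by rwa [hzw])
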